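/- For $n\ge 0$ let $S_n$ be the set of permutations of $\{1,\dots,n\}$. A permutation $\rho\in S_{n+1}$ covers $\pi\in S_n$ if some subsequence of $(\rho(1),\dots,\rho(n+1))$ is order-isomorphic to $(\pi(1),\dots,\pi(n))$. For $p\in[0,1]$, let $\mathcal A$ be the random subset of $S_{n+1}$ that contains each element of $S_{n+1}$ independently with probability $p$, let $X=X_{n,p}$ be the number of $\pi\in S_n$ that are covered by no element of $\mathcal A$, and let $\mathcal L(X_{n,p})$ be its law. Then $$\mathbb E(X_{n,p})=\lambda_{n,p}:=n!\,(1-p)^{n^2+1}\qquad\text{for all } n\ge 0,\ p\in[0,1].$$ Moreover, for every $\varepsilon>0$ and every sequence $(p_n)$ in $[0,1]$ with $p_n\ge (1+\varepsilon)\,\frac{\log n}{n^2}$ for all sufficiently large $n$, $$d_{TV}\bigl(\mathcal L(X_{n,p_n}),\mathrm{Poisson}(\lambda_{n,p_n})\bigr)\longrightarrow 0\qquad(n\to\infty),$$ where $d_{TV}(\mu,\nu)=\sup_{B\subseteq\{0,1,2,\dots\}}|\mu(B)-\nu(B)|$ for probability measures $\mu,\nu$ on $\{0,1,2,\dots\}$,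 and $\mathrm{Poisson}(0)$ is the point mass at $0$. -/

import Mathlib

open MeasureTheory ProbabilityTheory Filter Topology unitInterval
open scoped Nat NNReal

/-- The permutation `ρ` covers the permutation `π`: some subsequence of `ρ`, listed in increasing
order of positions by `f`, is order-isomorphic to `π`. -/
def Covers {m n : ℕ} (ρ : Equiv.Perm (Fin m)) (π : Equiv.Perm (Fin n)) : Prop :=
  ∃ f : Fin n ↪o Fin m, ∀ i j : Fin n, π i < π j ↔ ρ (f i) < ρ (f j)

/-- The number of `n`-permutations that are covered by no member of the collection `A` of
`(n+1)`-permutations. -/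
noncomputable def numUncovered (n : ℕ) (A : Set (Equiv.Perm (Fin (n + 1)))) : ℕ :=
  {π : Equiv.Perm (Fin n) | ∀ ρ ∈ A, ¬ Covers ρ π}.ncard

/-- The law of the random collection of `(n+1)`-permutations in which each `(n+1)`-permutation is
picked independently with probability `p`. -/
noncomputable def selectionModel (n : ℕ) (p : I) : Measure (Set (Equiv.Perm (Fin (n + 1)))) :=
  setBernoulli Set.univ p

/-- The law of the number of uncovered `n`-permutations in the independent selection model. -/
noncomputable def uncoveredLaw (n : ℕ) (p : I) : Measure ℕ :=
  (selectionModel n p).map (numUncovered n)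

/-- The parameter `n! (1 - p) ^ (n ^ 2 + 1)`, as a nonnegative real number. -/
noncomputable def uncoveredMean (n : ℕ) (p : I) : ℝ≥0 :=
  ⟨(n ! : ℝ) * (1 - (p : ℝ)) ^ (n ^ 2 + 1),
    mul_nonneg (Nat.cast_nonneg _) (pow_nonneg (sub_nonneg.2 p.2.2) _)⟩

/-- The total variation distance between two (probability) measures on `ℕ`. -/
noncomputable def tvDist (μ ν : Measure ℕ) : ℝ :=
  ⨆ S : Set ℕ, |μ.real S - ν.real S|

/-- The algebraic core of the bound on the increments of the solution of Stein's equation. -/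
lemma stein_increment_algebra {F R F₁ R₁ S T r w u W : ℝ} (hS : 0 ≤ S) (hT : 0 ≤ T)
    (hw : 0 ≤ w) (hu₁ : u ≤ 1) (hr : 0 ≤ r) (hF : 0 ≤ F) (hR₁ : 0 ≤ R₁)
    (hR : R₁ ≤ r * R) (hrF : r * F ≤ F₁) (hW : F₁ + R₁ = W) :
    (R₁ * (S + w * u) - F₁ * T) - r * (R * S - F * (T + w * u)) ≤ w * W := by
  have h1 : S * (R₁ - r * R) ≤ 0 := mul_nonpos_of_nonneg_of_nonpos hS (by linarith)
  have h2 : T * (r * F - F₁) ≤ 0 := mul_nonpos_of_nonneg_of_nonpos hT (by linarith)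
  have h3 : w * u * (R₁ + r * F) ≤ w * W := by
    have h4 : w * u ≤ w := mul_le_of_le_one_right hw hu₁
    have h5 : 0 ≤ R₁ + r * F := by positivity
    calc w * u * (R₁ + r * F) ≤ w * (R₁ + r * F) := mul_le_mul_of_nonneg_right h4 h5
      _ ≤ w * W := mul_le_mul_of_nonneg_left (by linarith) hw
  nlinarith

lemma hasSum_poisson_weights (x : ℝ) : HasSum (fun k : ℕ => x ^ k / (k ! : ℝ)) (Real.exp x) := by
  rw [Real.exp_eq_exp_ℝ]
  exact NormedSpace.expSeries_div_hasSum_exp x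

lemma poissonMeasure_real_eq_tsum (r : ℝ≥0) (S : Set ℕ) :
    (poissonMeasure r).real S =
      (∑' k, (r : ℝ) ^ k / (k ! : ℝ) * S.indicator 1 k) / Real.exp r := by
  have h : (poissonMeasure r).real S = ∫ k, S.indicator (1 : ℕ → ℝ) k ∂(poissonMeasure r) := by
    rw [integral_indicator_one (MeasurableSet.of_discrete)]
  rw [h, integral_poissonMeasure, ← tsum_div_const]
  refine tsum_congr fun k => ?_
  rw [Real.exp_neg, smul_eq_mul]
  field_simp

/-- The solution of Stein's equation for the Poisson distribution, with its increment bound. -/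
theorem exists_poisson_stein_solution (r : ℝ≥0) (hr : 0 < r) (S : Set ℕ) :
    ∃ g : ℕ → ℝ, (∀ k : ℕ, r * g (k + 1) - k * g k =
        S.indicator 1 k - (poissonMeasure r).real S) ∧
      ∀ k : ℕ, 1 ≤ k → |g (k + 1) - g k| ≤ 1 / r := by
  have hr' : (0 : ℝ) < r := hr
  set x : ℝ := (r : ℝ) with hx
  set w : ℕ → ℝ := fun k => x ^ k / (k ! : ℝ) with hwdef
  set f : ℕ → ℝ := S.indicator 1 with hfdef
  have hf0 (k) : 0 ≤ f k := Set.indicator_nonneg (fun _ _ => zero_le_one) _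
  have hf1 (k) : f k ≤ 1 := Set.indicator_le_self' (fun _ _ => zero_le_one) k
  have hw (k) : 0 < w k := by positivity
  have hws : HasSum w (Real.exp x) := hasSum_poisson_weights x
  have hwsum := hws.summable
  have hwf : Summable fun k => w k * f k :=
    Summable.of_nonneg_of_le (fun k => mul_nonneg (hw k).le (hf0 k))
      (fun k => mul_le_of_le_one_right (hw k).le (hf1 k)) hwsum
  have hrec (k : ℕ) : (k + 1) * w (k + 1) = x * w k := by
    simp only [hwdef, Nat.factorial_succ, Nat.cast_mul, Nat.cast_add, Nat.cast_one, pow_succ]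
    field_simp
  set F : ℕ → ℝ := fun k => ∑ i ∈ Finset.range k, w i with hF
  set U : ℕ → ℝ := fun k => ∑ i ∈ Finset.range k, w i * f i with hU
  set R : ℕ → ℝ := fun k => ∑' i, w (i + k) with hR
  set T : ℕ → ℝ := fun k => ∑' i, w (i + k) * f (i + k) with hT
  have hFR (k) : F k + R k = Real.exp x := by
    rw [← hws.tsum_eq]; exact hwsum.sum_add_tsum_nat_add k
  have hUT (k) : U k + T k = ∑' i, w i * f i := hwf.sum_add_tsum_nat_add k
  have hFs (k) : F (k + 1) = F k + w k := Finset.sum_range_succ _ _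
  have hUs (k) : U (k + 1) = U k + w k * f k := Finset.sum_range_succ _ _
  have hTs (k) : T k = T (k + 1) + w k * f k := by linarith [hUT k, hUT (k + 1), hUs k]
  have hwk (k) : Summable fun i => w (i + k) := (summable_nat_add_iff k).2 hwsum
  have hwfk (k) : Summable fun i => w (i + k) * f (i + k) :=
    (summable_nat_add_iff (f := fun i => w i * f i) k).2 hwf
  have hR0 (k) : 0 ≤ R k := tsum_nonneg fun i => (hw _).le
  have hF0 (k) : 0 ≤ F k := Finset.sum_nonneg fun i _ => (hw _).le
  have hT0 (k) : 0 ≤ T k := tsum_nonneg fun i => mul_nonneg (hw _).le (hf0 _)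
  have hU0 (k) : 0 ≤ U k := Finset.sum_nonneg fun i _ => mul_nonneg (hw _).le (hf0 _)
  have hTR (k) : T k ≤ R k :=
    (hwfk k).tsum_le_tsum (fun i => mul_le_of_le_one_right (hw _).le (hf1 _)) (hwk k)
  have hUF (k) : U k ≤ F k :=
    Finset.sum_le_sum fun i _ => mul_le_of_le_one_right (hw _).le (hf1 _)
  have hRr (k : ℕ) (hk : 1 ≤ k) : R (k + 1) ≤ x / k * R k := by
    rw [hR, ← tsum_mul_left]
    refine (hwk (k + 1)).tsum_le_tsum (fun i => ?_) ((hwk k).mul_left _)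
    have hk' : (0 : ℝ) < k := by exact_mod_cast hk
    have := hrec (i + k)
    have h2 : w (i + (k + 1)) = x * w (i + k) / ((i + k : ℕ) + 1) := by
      rw [← this, ← add_assoc]; field_simp
    rw [h2, div_mul_eq_mul_div]
    refine div_le_div_of_nonneg_left (mul_nonneg hr'.le (hw _).le) hk' ?_
    push_cast; linarith [(Nat.cast_nonneg i : (0 : ℝ) ≤ i)]
  have hFr (k : ℕ) (hk : 1 ≤ k) : x / k * F k ≤ F (k + 1) := by
    have h1 : F (k + 1) = ∑ i ∈ Finset.range k, w (i + 1) + w 0 := Finset.sum_range_succ' _ _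
    rw [h1, hF, Finset.mul_sum]
    have : ∑ i ∈ Finset.range k, x / k * w i ≤ ∑ i ∈ Finset.range k, w (i + 1) := by
      refine Finset.sum_le_sum fun i hi => ?_
      have h2 : w (i + 1) = x * w i / (i + 1) := by rw [← hrec i]; field_simp
      rw [h2, div_mul_eq_mul_div]
      refine div_le_div_of_nonneg_left (mul_nonneg hr'.le (hw _).le) (by positivity) ?_
      exact_mod_cast Finset.mem_range.1 hi
    linarith [hw 0]
  set N : ℕ → ℝ := fun k => R k * U k - F k * T k with hN
  have hWpos : 0 < Real.exp x := Real.exp_pos x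
  have hNs (k) : N (k + 1) - N k = Real.exp x * (w k * f k) - w k * ∑' i, w i * f i := by
    simp only [hN]
    have e1 : R (k + 1) = Real.exp x - F k - w k := by linarith [hFR (k + 1), hFs k]
    have e2 : R k = Real.exp x - F k := by linarith [hFR k]
    have e3 : T (k + 1) = (∑' i, w i * f i) - U k - w k * f k := by linarith [hUT (k + 1), hUs k]
    have e4 : T k = (∑' i, w i * f i) - U k := by linarith [hUT k]
    rw [e1, e2, e3, e4, hFs, hUs]; ring
  refine ⟨fun k => N k / (Real.exp x * (k * w k)), fun k => ?_, fun k hk => ?_⟩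
  · have h1 : x * (N (k + 1) / (Real.exp x * ((k + 1 : ℕ) * w (k + 1)))) =
        N (k + 1) / (Real.exp x * w k) := by
      push_cast
      rw [hrec]
      have := (hw k).ne'
      field_simp
    have h2 : k * (N k / (Real.exp x * (k * w k))) = N k / (Real.exp x * w k) := by
      rcases Nat.eq_zero_or_pos k with rfl | hk
      · simp [hN, hF, hU]
      · have := (hw k).ne'
        field_simp
    have h3 : (poissonMeasure r).real S = (∑' i, w i * f i) / Real.exp x :=
      poissonMeasure_real_eq_tsum r S
    rw [h1, h2, ← sub_div, hNs, h3]
    have := (hw k).ne'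
    field_simp
  · have hk' : (0 : ℝ) < k := by exact_mod_cast hk
    have h1 : N (k + 1) / (Real.exp x * ((k + 1 : ℕ) * w (k + 1))) - N k / (Real.exp x * (k * w k))
        = (N (k + 1) - x / k * N k) / (Real.exp x * (x * w k)) := by
      push_cast
      rw [hrec]
      have := (hw k).ne'
      field_simp
    have hr0 : 0 ≤ x / k := by positivity
    have up : N (k + 1) - x / k * N k ≤ w k * Real.exp x := by
      have := stein_increment_algebra (hU0 k) (hT0 (k + 1)) (hw k).le (hf1 k) hr0 (hF0 k)
        (hR0 (k + 1)) (hRr k hk) (hFr k hk) (hFR (k + 1))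
      simpa only [hN, hUs k, hTs k] using this
    have lo : -(N (k + 1) - x / k * N k) ≤ w k * Real.exp x := by
      have := stein_increment_algebra (sub_nonneg.2 (hUF k)) (sub_nonneg.2 (hTR (k + 1))) (hw k).le
        (sub_le_self 1 (hf0 k)) hr0 (hF0 k)
        (hR0 (k + 1)) (hRr k hk) (hFr k hk) (hFR (k + 1))
      refine le_trans (le_of_eq ?_) this
      have e1 : R k = R (k + 1) + w k := by linarith [hFR (k + 1), hFs k, hFR k]
      simp only [hN, hUs k, hTs k, hFs k, e1]; ring
    simp only [h1]
    rw [abs_div, abs_of_pos (mul_pos hWpos (mul_pos hr' (hw k))),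
      div_le_div_iff₀ (mul_pos hWpos (mul_pos hr' (hw k))) hr']
    have h3 := abs_le.2 ⟨by linarith, up⟩
    calc _ ≤ w k * Real.exp x * x := mul_le_mul_of_nonneg_right h3 hr'.le
      _ = _ := by ring

lemma abs_sub_le_of_increments {g : ℕ → ℝ} {c : ℝ} (h : ∀ k : ℕ, 1 ≤ k → |g (k + 1) - g k| ≤ c)
    {a b : ℕ} (ha : 1 ≤ a) (hab : a ≤ b) : |g b - g a| ≤ c * ((b : ℝ) - a) := by
  induction b, hab using Nat.le_induction with
  | base => simp
  | succ b hb ih =>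
    have h1 := h b (ha.trans hb)
    have h2 := abs_sub_le (g (b + 1)) (g b) (g a)
    push_cast
    linarith

lemma integral_setBernoulli_univ {ι : Type*} [Finite ι] [Fintype (Set ι)] (p : I) (G : Set ι → ℝ) :
    ∫ A, G A ∂(setBernoulli (Set.univ : Set ι) p) =
      ∑ A : Set ι, (p : ℝ) ^ A.ncard * (1 - p : ℝ) ^ (Aᶜ).ncard * G A := by
  rw [integral_fintype .of_finite]
  refine Finset.sum_congr rfl fun A _ => ?_
  rw [setBernoulli_real_singleton p (Set.subset_univ A) Set.finite_univ, smul_eq_mul,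
    Set.compl_eq_univ_sdiff]

open Classical in
/-- Conditioning on the absence of a point is the same as deleting the point. -/
lemma integral_setBernoulli_ite_notMem {ι : Type*} [Finite ι] (p : I) (a : ι) (G : Set ι → ℝ) :
    ∫ A, (if a ∈ A then 0 else G A) ∂(setBernoulli (Set.univ : Set ι) p) =
      (1 - p : ℝ) * ∫ A, G (A \ {a}) ∂(setBernoulli (Set.univ : Set ι) p) := by
  have := Fintype.ofFinite (Set ι)
  rw [integral_setBernoulli_univ, integral_setBernoulli_univ,
    ← Finset.sum_filter_add_sum_filter_not Finset.univ (fun A : Set ι => a ∈ A),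
    ← Finset.sum_filter_add_sum_filter_not Finset.univ (fun A : Set ι => a ∈ A)
      (fun A => (p : ℝ) ^ A.ncard * (1 - p : ℝ) ^ (Aᶜ).ncard * G (A \ {a}))]
  have h1 : ∑ A : Set ι with a ∈ A, (p : ℝ) ^ A.ncard * (1 - p : ℝ) ^ (Aᶜ).ncard *
      (if a ∈ A then 0 else G A) = 0 :=
    Finset.sum_eq_zero fun A hA => by simp [(Finset.mem_filter.1 hA).2]
  have h2 : (1 - p : ℝ) * ∑ A : Set ι with a ∈ A,
      (p : ℝ) ^ A.ncard * (1 - p : ℝ) ^ (Aᶜ).ncard * G (A \ {a}) =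
      p * ∑ A : Set ι with a ∉ A, (p : ℝ) ^ A.ncard * (1 - p : ℝ) ^ (Aᶜ).ncard * G A := by
    rw [Finset.mul_sum, Finset.mul_sum]
    refine Finset.sum_nbij' (fun A => A \ {a}) (fun A => insert a A) ?_ ?_ ?_ ?_ ?_
    · intro A hA; simp
    · intro A hA; simp
    · intro A hA
      simp only [Finset.mem_filter, Finset.mem_univ, true_and] at hA
      simp [Set.insert_eq_of_mem hA]
    · intro A hA
      simp only [Finset.mem_filter, Finset.mem_univ, true_and] at hA
      simp [hA]
    · intro A hA
      simp only [Finset.mem_filter, Finset.mem_univ, true_and] at hA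
      have e1 : A.ncard = (A \ {a}).ncard + 1 :=
        (Set.ncard_sdiff_singleton_add_one hA (Set.toFinite A)).symm
      have e2 : ((A \ {a})ᶜ).ncard = (Aᶜ).ncard + 1 := by
        have : (A \ {a})ᶜ = insert a Aᶜ := by
          ext x; simp only [Set.mem_compl_iff, Set.mem_sdiff, Set.mem_singleton_iff,
            Set.mem_insert_iff]; tauto
        rw [this, Set.ncard_insert_of_notMem (by simpa using hA) (Set.toFinite _)]
      rw [e1, e2]; ring
  rw [h1, mul_add, h2, zero_add, Finset.mul_sum, Finset.mul_sum, ← Finset.sum_add_distrib]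
  refine Finset.sum_congr rfl fun A hA => ?_
  have hA' := (Finset.mem_filter.1 hA).2
  simp only [if_neg hA', Set.sdiff_singleton_eq_self hA']
  ring

open Classical in
/-- Conditioning on the absence of a set of points is the same as deleting them. -/
lemma integral_setBernoulli_ite_disjoint {ι : Type*} [Finite ι] (p : I) (C : Set ι) (G : Set ι → ℝ) :
    ∫ A, (if Disjoint A C then G A else 0) ∂(setBernoulli (Set.univ : Set ι) p) =
      (1 - p : ℝ) ^ C.ncard * ∫ A, G (A \ C) ∂(setBernoulli (Set.univ : Set ι) p) := by
  induction C, Set.toFinite C using Set.Finite.induction_on generalizing G with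
  | empty => simp
  | @insert a C ha hC ih =>
    rw [Set.ncard_insert_of_notMem ha hC, pow_succ', mul_assoc]
    have h1 : ∀ A : Set ι, (if Disjoint A (insert a C) then G A else 0) =
        if a ∈ A then 0 else if Disjoint A C then G A else 0 := by
      intro A
      rw [Set.disjoint_insert_right]
      by_cases h : a ∈ A <;> simp [h]
    simp_rw [h1]
    rw [integral_setBernoulli_ite_notMem p a (fun A => if Disjoint A C then G A else 0)]
    have h2 : ∀ A : Set ι, (if Disjoint (A \ {a}) C then G (A \ {a}) else 0) =
        if Disjoint A C then G (A \ {a}) else 0 := by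
      intro A
      have : Disjoint (A \ {a}) C ↔ Disjoint A C := by
        simp only [Set.disjoint_left, Set.mem_sdiff, Set.mem_singleton_iff]
        exact ⟨fun h x hx hC => h ⟨hx, fun e => ha (e ▸ hC)⟩ hC, fun h x hx => h hx.1⟩
      simp [this]
    simp_rw [h2]
    rw [ih (fun A => G (A \ {a}))]
    have h3 : ∀ A : Set ι, (A \ C) \ {a} = A \ insert a C := by
      intro A; ext x
      simp only [Set.mem_sdiff, Set.mem_singleton_iff, Set.mem_insert_iff]; tauto
    simp_rw [h3]

/-- The number of members of the family `C` that the set `A` avoids. -/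
noncomputable def avoidCount {ι κ : Type*} (C : κ → Set ι) (A : Set ι) : ℕ :=
  {k | ∀ i ∈ A, i ∉ C k}.ncard

open Classical in
lemma avoidCount_eq_sum {ι κ : Type*} [Fintype κ] (C : κ → Set ι) (A : Set ι) :
    avoidCount C A = ∑ k, if Disjoint A (C k) then 1 else 0 := by
  rw [avoidCount, Finset.sum_boole, Set.ncard_eq_toFinset_card']
  simp [Set.disjoint_left]

lemma integral_avoidCount_sdiff {ι κ : Type*} [Finite ι] [Fintype κ]
    (p : I) (C : κ → Set ι) (D : Set ι) :
    ∫ A, (avoidCount C (A \ D) : ℝ) ∂(setBernoulli (Set.univ : Set ι) p) =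
      ∑ k, (1 - p : ℝ) ^ (C k \ D).ncard := by
  classical
  simp_rw [avoidCount_eq_sum, Nat.cast_sum]
  rw [integral_finsetSum _ fun _ _ => Integrable.of_finite]
  refine Finset.sum_congr rfl fun k _ => ?_
  have h := integral_setBernoulli_ite_disjoint p (C k \ D) (fun _ => (1 : ℝ))
  rw [integral_const, probReal_univ, one_smul, mul_one] at h
  rw [← h]
  refine integral_congr_ae (Eventually.of_forall fun A => ?_)
  have : Disjoint (A \ D) (C k) ↔ Disjoint A (C k \ D) := by
    simp only [Set.disjoint_left, Set.mem_sdiff]; grind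
  simp [this]

lemma integral_avoidCount {ι κ : Type*} [Finite ι] [Fintype κ]
    (p : I) (C : κ → Set ι) :
    ∫ A, (avoidCount C A : ℝ) ∂(setBernoulli (Set.univ : Set ι) p) =
      ∑ k, (1 - p : ℝ) ^ (C k).ncard := by
  simpa using integral_avoidCount_sdiff p C ∅

open Classical in
/-- Deleting the points of `C k` makes the set avoid `C k` and all that it avoided before. -/
lemma abs_avoidCount_coupling_le {ι κ : Type*} [Finite κ] (C : κ → Set ι) (k : κ) (A : Set ι) :
    1 ≤ avoidCount C (A \ C k) ∧
    |(avoidCount C A : ℝ) + 1 - avoidCount C (A \ C k)| ≤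
      avoidCount C (A \ C k) - avoidCount C A - 1 + 2 * (if Disjoint A (C k) then 1 else 0) := by
  have hk : k ∈ {j | ∀ i ∈ A \ C k, i ∉ C j} := fun i hi => hi.2
  refine ⟨(Set.ncard_pos (Set.toFinite _)).2 ⟨k, hk⟩, ?_⟩
  by_cases h : Disjoint A (C k)
  · rw [h.sdiff_eq_left]; simp [h]; norm_num
  · have hlt : avoidCount C A < avoidCount C (A \ C k) := by
      refine Set.ncard_lt_ncard (Set.ssubset_iff_subset_ne.2 ⟨fun j hj i hi => hj i hi.1, ?_⟩)
        (Set.toFinite _)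
      intro he
      rw [← he] at hk
      exact h (Set.disjoint_left.2 hk)
    have h1 : (avoidCount C A : ℝ) + 1 ≤ avoidCount C (A \ C k) := by exact_mod_cast hlt
    rw [abs_of_nonpos (by linarith)]
    simp [h]

/-- Poisson approximation, by the Stein–Chen method with a monotone coupling, of the number of
members of a family that are avoided by a random set. -/
theorem abs_avoidCount_sub_poisson_le {ι κ : Type*} [Finite ι] [Fintype κ]
    (p : I) (C : κ → Set ι) (N : ℕ)
    (hC : ∀ k, (C k).ncard = N) (r : ℝ≥0) (hr : 0 < r)
    (hrC : (r : ℝ) = Fintype.card κ * (1 - p : ℝ) ^ N) (B : ℝ)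
    (hB : ∀ k, ∑ j, ((1 - p : ℝ) ^ (C j \ C k).ncard - (1 - p : ℝ) ^ N) ≤ 1 + B) (S : Set ℕ) :
    |((setBernoulli (Set.univ : Set ι) p).map (avoidCount C)).real S -
      (poissonMeasure r).real S| ≤ 2 * (1 - p : ℝ) ^ N + B := by
  classical
  set μ := setBernoulli (Set.univ : Set ι) p with hμ
  set X := avoidCount C with hX
  set q : ℝ := (1 - p : ℝ) ^ N with hq
  have hr' : (0 : ℝ) < r := hr
  have hq0 : 0 ≤ q := pow_nonneg (sub_nonneg.2 p.2.2) _
  obtain ⟨g, hg, hinc⟩ := exists_poisson_stein_solution r hr S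
  have hlip : ∀ a b : ℕ, 1 ≤ a → 1 ≤ b → |g a - g b| ≤ 1 / r * |(a : ℝ) - b| := by
    intro a b ha hb
    rcases le_total a b with h | h
    · rw [abs_sub_comm, abs_sub_comm (a : ℝ),
        abs_of_nonneg (sub_nonneg.2 (by exact_mod_cast h : (a : ℝ) ≤ b))]
      exact abs_sub_le_of_increments hinc ha h
    · rw [abs_of_nonneg (sub_nonneg.2 (by exact_mod_cast h : (b : ℝ) ≤ a))]
      exact abs_sub_le_of_increments hinc hb h
  have hlaw : (μ.map X).real S - (poissonMeasure r).real S =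
      ∫ A, (r * g (X A + 1) - X A * g (X A)) ∂μ := by
    simp_rw [hg]
    rw [integral_sub Integrable.of_finite Integrable.of_finite, integral_const, probReal_univ,
      one_smul, map_measureReal_apply .of_discrete .of_discrete]
    congr 1
    rw [← integral_indicator_one (MeasurableSet.of_discrete)]
    rfl
  have hterm : ∀ k, ∫ A, (if Disjoint A (C k) then g (X A) else 0) ∂μ =
      q * ∫ A, g (X (A \ C k)) ∂μ := by
    intro k
    rw [integral_setBernoulli_ite_disjoint p (C k) (fun A => g (X A)), hC]
  have hexp : ∫ A, (r * g (X A + 1) - X A * g (X A)) ∂μ =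
      ∑ k, q * ∫ A, (g (X A + 1) - g (X (A \ C k))) ∂μ := by
    have h1 : ∀ A, (X A : ℝ) * g (X A) = ∑ k, if Disjoint A (C k) then g (X A) else 0 := by
      intro A
      rw [hX, avoidCount_eq_sum, Nat.cast_sum, Finset.sum_mul]
      exact Finset.sum_congr rfl fun k _ => by split_ifs <;> simp
    simp_rw [h1]
    rw [integral_sub Integrable.of_finite Integrable.of_finite,
      integral_finsetSum _ fun _ _ => Integrable.of_finite, integral_const_mul]
    simp_rw [hterm, integral_sub Integrable.of_finite Integrable.of_finite, mul_sub]
    rw [Finset.sum_sub_distrib, Finset.sum_const, Finset.card_univ, nsmul_eq_mul, hrC, mul_assoc]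
  have hbound : ∀ k, |∫ A, (g (X A + 1) - g (X (A \ C k))) ∂μ| ≤ 1 / r * (2 * q + B) := by
    intro k
    calc |∫ A, (g (X A + 1) - g (X (A \ C k))) ∂μ|
        ≤ ∫ A, |g (X A + 1) - g (X (A \ C k))| ∂μ := abs_integral_le_integral_abs
      _ ≤ ∫ A, 1 / r * (((X (A \ C k) : ℝ) - X A - 1) +
            2 * (if Disjoint A (C k) then 1 else 0)) ∂μ := by
          refine integral_mono Integrable.of_finite Integrable.of_finite fun A => ?_
          obtain ⟨h1, h2⟩ := abs_avoidCount_coupling_le C k A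
          refine (hlip _ _ (Nat.le_add_left 1 _) h1).trans
            (mul_le_mul_of_nonneg_left ?_ (by positivity))
          push_cast
          exact h2
      _ = 1 / r * (∑ j, ((1 - p : ℝ) ^ (C j \ C k).ncard - q) - 1 + 2 * q) := by
          rw [integral_const_mul, integral_add Integrable.of_finite Integrable.of_finite,
            integral_sub Integrable.of_finite Integrable.of_finite,
            integral_sub Integrable.of_finite Integrable.of_finite, integral_const_mul,
            integral_avoidCount_sdiff, integral_avoidCount,
            integral_setBernoulli_ite_disjoint p (C k) (fun _ => (1 : ℝ))]
          simp only [hC, integral_const, probReal_univ, one_smul, mul_one,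
            Finset.sum_sub_distrib, ← hq]
      _ ≤ 1 / r * (2 * q + B) := by
          refine mul_le_mul_of_nonneg_left ?_ (by positivity)
          linarith [hB k]
  rw [hlaw, hexp]
  calc |∑ k, q * ∫ A, (g (X A + 1) - g (X (A \ C k))) ∂μ|
      ≤ ∑ k, |q * ∫ A, (g (X A + 1) - g (X (A \ C k))) ∂μ| := Finset.abs_sum_le_sum_abs _ _
    _ ≤ ∑ _k : κ, q * (1 / r * (2 * q + B)) := by
        refine Finset.sum_le_sum fun k _ => ?_
        rw [abs_mul, abs_of_nonneg hq0]
        exact mul_le_mul_of_nonneg_left (hbound k) hq0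
    _ = 2 * q + B := by
        rw [Finset.sum_const, Finset.card_univ, nsmul_eq_mul, ← mul_assoc, ← mul_assoc, ← hrC]
        field_simp

/-- Deleting the entry of `ρ` at position `i` leaves a sequence order-isomorphic to `π`. -/
def DeletesTo {n : ℕ} (ρ : Equiv.Perm (Fin (n + 1))) (π : Equiv.Perm (Fin n))
    (i : Fin (n + 1)) : Prop :=
  ∀ a : Fin n, ρ (i.succAbove a) = (ρ i).succAbove (π a)

lemma strictMono_eq_succAbove {n : ℕ} {g : Fin n → Fin (n + 1)} (hg : StrictMono g)
    {i : Fin (n + 1)} (hi : ∀ a, g a ≠ i) : g = i.succAbove := by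
  refine (hg.range_inj (Fin.strictMono_succAbove i)).1 ?_
  rw [Fin.range_succAbove]
  refine Set.eq_of_subset_of_ncard_le ?_ ?_ (Set.toFinite _)
  · rintro _ ⟨a, rfl⟩; exact hi a
  · rw [← Set.image_univ, Set.ncard_image_of_injective _ hg.injective, Set.ncard_univ,
      Set.ncard_compl]
    simp

lemma covers_iff_exists_deletesTo {n : ℕ} (ρ : Equiv.Perm (Fin (n + 1)))
    (π : Equiv.Perm (Fin n)) : Covers ρ π ↔ ∃ i, DeletesTo ρ π i := by
  constructor
  · rintro ⟨f, hf⟩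
    obtain ⟨i, hi⟩ : ∃ i, ∀ a, f a ≠ i := by
      by_contra! h
      have := Fintype.card_le_of_surjective f h
      simp at this
    refine ⟨i, fun a => ?_⟩
    have h1 : ⇑f = i.succAbove := strictMono_eq_succAbove f.strictMono hi
    have h2 : (fun b => ρ (f (π.symm b))) = (ρ i).succAbove := by
      refine strictMono_eq_succAbove (fun b c hbc => ?_) fun b hb => hi _ (ρ.injective hb)
      exact (hf _ _).1 (by simpa using hbc)
    have h3 := congrFun h2 (π a)
    simpa [h1] using h3
  · rintro ⟨i, hi⟩
    refine ⟨Fin.succAboveOrderEmb i, fun a b => ?_⟩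
    simp only [Fin.succAboveOrderEmb_apply]
    rw [hi, hi, Fin.succAbove_lt_succAbove_iff]

/-- The permutation obtained from `π` by inserting the value `j` at position `i`. -/
def insertEntry {n : ℕ} (π : Equiv.Perm (Fin n)) (i j : Fin (n + 1)) :
    Equiv.Perm (Fin (n + 1)) :=
  (finSuccEquiv' i).trans ((Equiv.optionCongr π).trans (finSuccEquiv' j).symm)

lemma insertEntry_self {n : ℕ} (π : Equiv.Perm (Fin n)) (i j : Fin (n + 1)) :
    insertEntry π i j i = j := by
  simp [insertEntry]

lemma deletesTo_insertEntry {n : ℕ} (π : Equiv.Perm (Fin n)) (i j : Fin (n + 1)) :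
    DeletesTo (insertEntry π i j) π i := by
  intro a
  rw [insertEntry_self]
  simp [insertEntry]

lemma DeletesTo.eq_insertEntry {n : ℕ} {ρ : Equiv.Perm (Fin (n + 1))} {π : Equiv.Perm (Fin n)}
    {i : Fin (n + 1)} (h : DeletesTo ρ π i) : ρ = insertEntry π i (ρ i) := by
  refine Equiv.ext ((Fin.forall_iff_succAbove i).2 ⟨(insertEntry_self π i (ρ i)).symm, fun a => ?_⟩)
  rw [h a, deletesTo_insertEntry π i (ρ i) a, insertEntry_self]

lemma DeletesTo.unique {n : ℕ} {ρ : Equiv.Perm (Fin (n + 1))} {π π' : Equiv.Perm (Fin n)}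
    {i : Fin (n + 1)} (h : DeletesTo ρ π i) (h' : DeletesTo ρ π' i) : π = π' :=
  Equiv.ext fun a => Fin.succAbove_right_injective ((h a).symm.trans (h' a))

lemma succAbove_castSucc_eq_succAbove_succ {n : ℕ} {a b : Fin n} (h : b ≠ a) :
    a.castSucc.succAbove b = a.succ.succAbove b := by
  rcases lt_or_gt_of_ne h with h | h
  · rw [Fin.succAbove_of_castSucc_lt _ _ (by simpa using h),
      Fin.succAbove_of_castSucc_lt _ _ (by simpa using h.le)]
  · rw [Fin.succAbove_of_le_castSucc _ _ (by simpa using h.le),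
      Fin.succAbove_of_le_castSucc _ _ (Nat.succ_le_of_lt h)]

lemma succAbove_eq_castSucc_or_succ {n : ℕ} (i : Fin (n + 1)) (a : Fin n) :
    i.succAbove a = a.castSucc ∨ i.succAbove a = a.succ := by
  rw [Fin.succAbove]; split_ifs <;> simp

/-- If consecutive entries have adjacent values, either of them can be deleted. -/
lemma DeletesTo.pred {n : ℕ} {ρ : Equiv.Perm (Fin (n + 1))} {π : Equiv.Perm (Fin n)}
    {a : Fin n} (h : DeletesTo ρ π a.succ)
    (ha : ρ a.succ = (π a).castSucc ∨ ρ a.succ = (π a).succ) : DeletesTo ρ π a.castSucc := by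
  have h1 : ρ a.castSucc = (ρ a.succ).succAbove (π a) := by
    rw [← h a, Fin.succAbove_succ_self]
  intro b
  by_cases hb : b = a
  · subst hb
    rw [h1, Fin.succAbove_castSucc_self]
    rcases ha with e | e <;> rw [e] <;> simp
  · have hπ : π b ≠ π a := fun e => hb (π.injective e)
    rw [succAbove_castSucc_eq_succAbove_succ hb, h b, h1]
    rcases ha with e | e <;> rw [e]
    · rw [Fin.succAbove_castSucc_self, succAbove_castSucc_eq_succAbove_succ hπ]
    · rw [Fin.succAbove_succ_self, succAbove_castSucc_eq_succAbove_succ hπ]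

/-- The insertion of the value `j` at position `i` does not put it next to an adjacent value on its
left. -/
def IsCanonicalInsertion {n : ℕ} (π : Equiv.Perm (Fin n)) (x : Fin (n + 1) × Fin (n + 1)) :
    Prop :=
  ∀ a : Fin n, a.succ = x.1 → x.2 ≠ (π a).castSucc ∧ x.2 ≠ (π a).succ

lemma bijOn_insertEntry {n : ℕ} (π : Equiv.Perm (Fin n)) :
    Set.BijOn (fun x : Fin (n + 1) × Fin (n + 1) => insertEntry π x.1 x.2)
      {x | IsCanonicalInsertion π x} {ρ | Covers ρ π} := by
  have key : ∀ x y : Fin (n + 1) × Fin (n + 1), IsCanonicalInsertion π y →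
      insertEntry π x.1 x.2 = insertEntry π y.1 y.2 → ¬ x.1 < y.1 := by
    rintro ⟨i, j⟩ ⟨i', j'⟩ hy he hlt
    simp only at he hlt
    have h0 : i' ≠ 0 := (lt_of_le_of_lt (Fin.zero_le i) hlt).ne'
    obtain ⟨a, rfl⟩ := Fin.exists_succ_eq_of_ne_zero h0
    have h1 := deletesTo_insertEntry π i j a
    rw [Fin.succAbove_of_le_castSucc _ _ (Fin.le_castSucc_iff.2 hlt),
      insertEntry_self, he, insertEntry_self] at h1
    obtain ⟨h2, h3⟩ := hy a rfl
    rcases succAbove_eq_castSucc_or_succ j (π a) with e | e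
    · exact h2 (h1.trans e)
    · exact h3 (h1.trans e)
  refine ⟨fun x _ => (covers_iff_exists_deletesTo _ _).2 ⟨x.1, deletesTo_insertEntry _ _ _⟩,
    fun x hx y hy he => ?_, fun ρ hρ => ?_⟩
  · have h1 : x.1 = y.1 :=
      le_antisymm (not_lt.1 (key y x hx he.symm)) (not_lt.1 (key x y hy he))
    refine Prod.ext h1 ?_
    have h2 := congrArg (fun τ : Equiv.Perm (Fin (n + 1)) => τ x.1) he
    simp only [insertEntry_self] at h2
    rw [h2, h1, insertEntry_self]
  · obtain ⟨i, hi, hmin⟩ := WellFounded.has_min (wellFounded_lt (α := Fin (n + 1)))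
      {i | DeletesTo ρ π i} ((covers_iff_exists_deletesTo _ _).1 hρ)
    refine ⟨(i, ρ i), fun a ha => ?_, (DeletesTo.eq_insertEntry hi).symm⟩
    simp only at ha
    subst ha
    by_contra hcon
    refine hmin a.castSucc (DeletesTo.pred hi ?_) (by simp)
    by_contra! h
    exact hcon h

/-- Every permutation of length `n` is covered by `n ^ 2 + 1` permutations of length `n + 1`. -/
theorem ncard_covers {n : ℕ} (π : Equiv.Perm (Fin n)) :
    {ρ : Equiv.Perm (Fin (n + 1)) | Covers ρ π}.ncard = n ^ 2 + 1 := by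
  classical
  rw [← (bijOn_insertEntry π).image_eq, (bijOn_insertEntry π).injOn.ncard_image]
  have h1 : {x | IsCanonicalInsertion π x} = ((Finset.univ.sigma fun i : Fin (n + 1) =>
      Finset.univ.filter fun j => IsCanonicalInsertion π (i, j)).map
        (Equiv.sigmaEquivProd _ _).toEmbedding : Finset _) := by
    ext ⟨i, j⟩; simp
  rw [h1, Set.ncard_coe_finset, Finset.card_map, Finset.card_sigma, Fin.sum_univ_succ]
  have h2 : (Finset.univ.filter fun j => IsCanonicalInsertion π (0, j)).card = n + 1 := by
    rw [Finset.filter_true_of_mem fun j _ a ha => absurd ha (Fin.succ_ne_zero a)]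
    simp
  have h3 : ∀ a : Fin n,
      (Finset.univ.filter fun j => IsCanonicalInsertion π (a.succ, j)).card = n - 1 := by
    intro a
    have : (Finset.univ.filter fun j => IsCanonicalInsertion π (a.succ, j)) =
        ({(π a).castSucc, (π a).succ} : Finset (Fin (n + 1)))ᶜ := by
      ext j
      simp only [IsCanonicalInsertion, Finset.mem_filter, Finset.mem_univ, true_and,
        Finset.mem_compl, Finset.mem_insert, Finset.mem_singleton, not_or, Fin.succ_inj]
      exact ⟨fun h => h a rfl, fun h b hb => hb ▸ h⟩
    rw [this, Finset.card_compl, Finset.card_pair (Fin.castSucc_lt_succ).ne, Fintype.card_fin]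
    omega
  simp only [h2, h3, Finset.sum_const, Finset.card_univ, Fintype.card_fin, smul_eq_mul]
  cases n with
  | zero => simp
  | succ m => simp; ring

/-- Two distinct permutations of length `n` have at most `4 * n` common covers. -/
theorem ncard_common_covers_le {n : ℕ} {π π' : Equiv.Perm (Fin n)} (h : π ≠ π') :
    ({ρ : Equiv.Perm (Fin (n + 1)) | Covers ρ π} ∩ {ρ | Covers ρ π'}).ncard ≤ 4 * n := by
  let F : Fin n × Bool × Bool → Equiv.Perm (Fin (n + 1)) := fun x =>
    insertEntry π (bif x.2.1 then x.1.castSucc else x.1.succ)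
      (bif x.2.2 then (π' x.1).castSucc else (π' x.1).succ)
  have hsub : ({ρ : Equiv.Perm (Fin (n + 1)) | Covers ρ π} ∩ {ρ | Covers ρ π'}) ⊆
      F '' Set.univ := by
    rintro ρ ⟨h1, h2⟩
    obtain ⟨i, hi⟩ := (covers_iff_exists_deletesTo _ _).1 h1
    obtain ⟨k, hk⟩ := (covers_iff_exists_deletesTo _ _).1 h2
    have hne : i ≠ k := fun e => h (hi.unique (e ▸ hk))
    obtain ⟨a, ha⟩ := Fin.exists_succAbove_eq hne
    have hv : ρ i = (ρ k).succAbove (π' a) := by rw [← ha, hk a]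
    have e := hi.eq_insertEntry
    rcases succAbove_eq_castSucc_or_succ k a with e1 | e1 <;>
      rcases succAbove_eq_castSucc_or_succ (ρ k) (π' a) with e2 | e2 <;>
      rw [hv, e2, ← ha, e1] at e
    · exact ⟨(a, true, true), trivial, e.symm⟩
    · exact ⟨(a, true, false), trivial, e.symm⟩
    · exact ⟨(a, false, true), trivial, e.symm⟩
    · exact ⟨(a, false, false), trivial, e.symm⟩
  calc _ ≤ (F '' Set.univ).ncard := Set.ncard_le_ncard hsub (Set.toFinite _)
    _ ≤ (Set.univ : Set (Fin n × Bool × Bool)).ncard := Set.ncard_image_le (Set.toFinite _)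
    _ = 4 * n := by rw [Set.ncard_univ]; simp; ring

lemma ncard_covered_le {n : ℕ} (ρ : Equiv.Perm (Fin (n + 1))) :
    {π : Equiv.Perm (Fin n) | Covers ρ π}.ncard ≤ n + 1 := by
  have h : ∀ π : Equiv.Perm (Fin n), ∃ i, Covers ρ π → DeletesTo ρ π i := by
    intro π
    by_cases hc : Covers ρ π
    · obtain ⟨i, hi⟩ := (covers_iff_exists_deletesTo _ _).1 hc
      exact ⟨i, fun _ => hi⟩
    · exact ⟨0, fun h => absurd h hc⟩
  choose f hf using h
  calc _ ≤ (Set.univ : Set (Fin (n + 1))).ncard :=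
        Set.ncard_le_ncard_of_injOn f (fun _ _ => trivial)
          (fun π hπ π' hπ' e => (hf π hπ).unique (e ▸ hf π' hπ')) (Set.toFinite _)
    _ = n + 1 := by rw [Set.ncard_univ]; simp

lemma sum_ncard_common_covers_le {n : ℕ} (π : Equiv.Perm (Fin n)) :
    ∑ π' : Equiv.Perm (Fin n),
      ({ρ : Equiv.Perm (Fin (n + 1)) | Covers ρ π'} ∩ {ρ | Covers ρ π}).ncard ≤
      (n ^ 2 + 1) * (n + 1) := by
  classical
  have h1 : ∀ π' : Equiv.Perm (Fin n),
      ({ρ : Equiv.Perm (Fin (n + 1)) | Covers ρ π'} ∩ {ρ | Covers ρ π}).ncard =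
      ∑ ρ : Equiv.Perm (Fin (n + 1)) with Covers ρ π, if Covers ρ π' then 1 else 0 := by
    intro π'
    rw [Finset.sum_boole, Finset.filter_filter, Set.ncard_eq_toFinset_card']
    congr 1
    ext ρ; simp [and_comm]
  simp_rw [h1]
  rw [Finset.sum_comm]
  calc _ ≤ ∑ ρ : Equiv.Perm (Fin (n + 1)) with Covers ρ π, (n + 1) := by
        refine Finset.sum_le_sum fun ρ _ => ?_
        refine le_trans (le_of_eq ?_) (ncard_covered_le ρ)
        rw [Finset.sum_boole, Set.ncard_eq_toFinset_card']
        simp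
    _ = (n ^ 2 + 1) * (n + 1) := by
        rw [Finset.sum_const, smul_eq_mul, ← ncard_covers π, Set.ncard_eq_toFinset_card']
        simp

lemma pow_sub_pow_le_mul {x : ℝ} (hx : x ∈ Set.Icc (0 : ℝ) 1) {N M c : ℕ} (hc : c + M ≤ N) :
    (1 - x) ^ (N - c) - (1 - x) ^ N ≤ c * (x * (1 - x) ^ M) := by
  have h0 : 0 ≤ 1 - x := sub_nonneg.2 hx.2
  have h1 : (1 - x) ^ N = (1 - x) ^ (N - c) * (1 - x) ^ c := by
    rw [← pow_add]; congr 1; omega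
  have h2 : 1 - c * x ≤ (1 - x) ^ c := by
    have := one_add_mul_le_pow (a := -x) (by linarith [hx.2]) c
    rw [← sub_eq_add_neg] at this
    linarith
  have h3 : (1 - x) ^ (N - c) ≤ (1 - x) ^ M :=
    pow_le_pow_of_le_one h0 (by linarith [hx.1]) (by omega)
  have h4 : 0 ≤ c * x := mul_nonneg (Nat.cast_nonneg _) hx.1
  calc (1 - x) ^ (N - c) - (1 - x) ^ N = (1 - x) ^ (N - c) * (1 - (1 - x) ^ c) := by rw [h1]; ring
    _ ≤ (1 - x) ^ (N - c) * (c * x) :=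
        mul_le_mul_of_nonneg_left (by linarith) (pow_nonneg h0 _)
    _ ≤ (1 - x) ^ M * (c * x) := mul_le_mul_of_nonneg_right h3 h4
    _ = _ := by ring

lemma poissonMeasure_zero : poissonMeasure 0 = Measure.dirac 0 := by
  refine Measure.ext_of_singleton fun k => ?_
  rw [poissonMeasure_singleton]
  cases k <;> simp

/-- The excess of conditional over unconditional avoidance probabilities, summed over all
permutations. -/
lemma sum_avoidance_excess_le {n : ℕ} (hn : 4 ≤ n) (p : I) (π : Equiv.Perm (Fin n)) :
    ∑ π' : Equiv.Perm (Fin n),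
      ((1 - p : ℝ) ^ ({ρ : Equiv.Perm (Fin (n + 1)) | Covers ρ π'} \ {ρ | Covers ρ π}).ncard -
        (1 - p : ℝ) ^ (n ^ 2 + 1)) ≤
      1 + ((n : ℝ) ^ 2 + 1) * (n + 1) * (p * (1 - p : ℝ) ^ (n ^ 2 - 4 * n)) := by
  classical
  have hp0 : (0 : ℝ) ≤ 1 - p := sub_nonneg.2 p.2.2
  set E : ℝ := p * (1 - p : ℝ) ^ (n ^ 2 - 4 * n) with hE
  have hE0 : 0 ≤ E := mul_nonneg p.2.1 (pow_nonneg hp0 _)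
  set c : Equiv.Perm (Fin n) → ℕ := fun π' =>
    ({ρ : Equiv.Perm (Fin (n + 1)) | Covers ρ π'} ∩ {ρ | Covers ρ π}).ncard with hc
  have hterm : ∀ π' : Equiv.Perm (Fin n),
      (1 - p : ℝ) ^ ({ρ : Equiv.Perm (Fin (n + 1)) | Covers ρ π'} \ {ρ | Covers ρ π}).ncard -
        (1 - p : ℝ) ^ (n ^ 2 + 1) ≤ (if π' = π then 1 else 0) + c π' * E := by
    intro π'
    by_cases h : π' = π
    · subst h
      have h1 := pow_nonneg hp0 (n ^ 2 + 1)
      have h2 : 0 ≤ (c π' : ℝ) * E := mul_nonneg (Nat.cast_nonneg _) hE0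
      simp; linarith
    · have h1 : ({ρ : Equiv.Perm (Fin (n + 1)) | Covers ρ π'} \ {ρ | Covers ρ π}).ncard =
          n ^ 2 + 1 - c π' := by
        have := Set.ncard_inter_add_ncard_sdiff_eq_ncard
          {ρ : Equiv.Perm (Fin (n + 1)) | Covers ρ π'} {ρ | Covers ρ π} (Set.toFinite _)
        rw [ncard_covers] at this
        simp only [hc]; omega
      have h2 : c π' ≤ 4 * n := ncard_common_covers_le h
      have h3 : 4 * n ≤ n ^ 2 := by nlinarith
      rw [h1, if_neg h, zero_add]
      exact pow_sub_pow_le_mul p.2 (by omega)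
  calc _ ≤ ∑ π' : Equiv.Perm (Fin n), ((if π' = π then 1 else 0) + c π' * E) :=
        Finset.sum_le_sum fun π' _ => hterm π'
    _ = 1 + ((∑ π', c π' : ℕ) : ℝ) * E := by
        rw [Finset.sum_add_distrib, ← Finset.sum_mul, Nat.cast_sum]; simp
    _ ≤ _ := by
        have h : ((∑ π', c π' : ℕ) : ℝ) ≤ ((n ^ 2 + 1) * (n + 1) : ℕ) := by
          exact_mod_cast sum_ncard_common_covers_le π
        push_cast at h
        have := mul_le_mul_of_nonneg_right h hE0
        push_cast
        linarith

lemma integral_numUncovered (n : ℕ) (q : I) :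
    ∫ A, (numUncovered n A : ℝ) ∂(selectionModel n q) =
      (n ! : ℝ) * (1 - (q : ℝ)) ^ (n ^ 2 + 1) := by
  have h := integral_avoidCount q
    fun π : Equiv.Perm (Fin n) => {ρ : Equiv.Perm (Fin (n + 1)) | Covers ρ π}
  simp only [ncard_covers, Finset.sum_const, Finset.card_univ, Fintype.card_perm,
    Fintype.card_fin, nsmul_eq_mul] at h
  exact h

/-- A quantitative Poisson approximation for the number of uncovered permutations. -/
theorem tvDist_uncoveredLaw_le {n : ℕ} (hn : 4 ≤ n) (p : I) :
    tvDist (uncoveredLaw n p) (poissonMeasure (uncoveredMean n p)) ≤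
      2 * (1 - p : ℝ) ^ (n ^ 2 + 1) +
        ((n : ℝ) ^ 2 + 1) * (n + 1) * (p * (1 - p : ℝ) ^ (n ^ 2 - 4 * n)) := by
  refine ciSup_le fun S => ?_
  have hp0 : (0 : ℝ) ≤ 1 - p := sub_nonneg.2 p.2.2
  rcases eq_or_lt_of_le (zero_le (a := uncoveredMean n p)) with h0 | hpos
  · have h1 : (n ! : ℝ) * (1 - (p : ℝ)) ^ (n ^ 2 + 1) = 0 := congrArg NNReal.toReal h0.symm
    have h2 : (p : ℝ) = 1 := by
      rcases mul_eq_zero.1 h1 with h | h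
      · exact absurd h (by exact_mod_cast n.factorial_ne_zero)
      · linarith [(pow_eq_zero_iff (Nat.succ_ne_zero (n ^ 2))).1 h]
    have h3 : p = 1 := Subtype.ext h2
    have h4 : numUncovered n Set.univ = 0 := by
      rw [numUncovered, Set.ncard_eq_zero (Set.toFinite _), Set.eq_empty_iff_forall_notMem]
      intro π hπ
      have : {ρ : Equiv.Perm (Fin (n + 1)) | Covers ρ π} = ∅ :=
        Set.eq_empty_iff_forall_notMem.2 fun ρ hρ => hπ ρ trivial hρ
      have h5 := ncard_covers π
      rw [this] at h5
      simp at h5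
    have h5 : uncoveredLaw n p = poissonMeasure (uncoveredMean n p) := by
      rw [← h0, poissonMeasure_zero, uncoveredLaw, selectionModel, h3, setBernoulli_one,
        Measure.map_dirac, h4]
    rw [h5, sub_self, abs_zero]
    have := p.2.1
    positivity
  · exact abs_avoidCount_sub_poisson_le p
      (fun π : Equiv.Perm (Fin n) => {ρ : Equiv.Perm (Fin (n + 1)) | Covers ρ π})
      (n ^ 2 + 1) ncard_covers _ hpos
      (by rw [Fintype.card_perm, Fintype.card_fin]; rfl) _ (sum_avoidance_excess_le hn p) S

/-- The error bound decays polynomially as soon as `p ≥ (1 + ε) log n / n ^ 2`. -/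
lemma approximation_error_le {ε : ℝ} (hε : 0 < ε) {n : ℕ} (hn : 4 ≤ n)
    (hn' : 8 * (1 + ε) / ε ≤ n) {p : ℝ} (hp : p ∈ Set.Icc (0 : ℝ) 1)
    (h : (1 + ε) * (Real.log n / (n : ℝ) ^ 2) ≤ p) :
    2 * (1 - p) ^ (n ^ 2 + 1) + ((n : ℝ) ^ 2 + 1) * (n + 1) * (p * (1 - p) ^ (n ^ 2 - 4 * n)) ≤
      (2 + 16 * (1 + ε) / ε) * (n : ℝ) ^ (-(ε / 4)) := by
  have hn0 : (4 : ℝ) ≤ n := by exact_mod_cast hn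
  have hnpos : (0 : ℝ) < n := by linarith
  have hp1 : 0 ≤ 1 - p := sub_nonneg.2 hp.2
  have hlog : 0 ≤ Real.log n := Real.log_nonneg (by linarith)
  have hexp : ∀ M : ℕ, (1 - p) ^ M ≤ Real.exp (-(p * M)) := by
    intro M
    calc (1 - p) ^ M ≤ (Real.exp (-p)) ^ M :=
          pow_le_pow_left₀ hp1 (Real.one_sub_le_exp_neg p) M
      _ = Real.exp (-(p * M)) := by rw [← Real.exp_nat_mul]; congr 1; ring
  set y : ℝ := p * (n : ℝ) ^ 2 with hy
  have hyl : (1 + ε) * Real.log n ≤ y := by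
    have := mul_le_mul_of_nonneg_right h (sq_nonneg (n : ℝ))
    calc (1 + ε) * Real.log n = (1 + ε) * (Real.log n / (n : ℝ) ^ 2) * (n : ℝ) ^ 2 := by
          field_simp
      _ ≤ y := this
  have hy0 : 0 ≤ y := mul_nonneg hp.1 (sq_nonneg _)
  set K : ℝ := (n : ℝ) ^ (-(ε / 4)) with hK
  have hKexp : K = Real.exp (-(ε / 4) * Real.log n) := by
    rw [hK, Real.rpow_def_of_pos hnpos, mul_comm]
  have first : (1 - p) ^ (n ^ 2 + 1) ≤ K := by
    refine (hexp _).trans ?_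
    rw [hKexp, Real.exp_le_exp]
    push_cast
    nlinarith [hp.1]
  set d : ℝ := ε / (4 * (1 + ε)) with hd
  have hd0 : 0 < d := by positivity
  have hdε : d * (1 + ε) = ε / 4 := by rw [hd]; field_simp
  have hdn : 4 * (n : ℝ) ≤ 2 * d * (n : ℝ) ^ 2 := by
    have h1 : 8 * (1 + ε) ≤ n * ε := by rwa [div_le_iff₀ hε] at hn'
    have h2 : 2 ≤ d * n := by
      rw [hd, div_mul_eq_mul_div, le_div_iff₀ (by positivity)]; linarith
    nlinarith
  have second : p * (1 - p) ^ (n ^ 2 - 4 * n) ≤ 1 / (n : ℝ) ^ 2 * (1 / d) * (K / n) := by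
    have h3 : 4 * n ≤ n ^ 2 := by nlinarith
    have h4 : (1 - p) ^ (n ^ 2 - 4 * n) ≤ Real.exp (-(d * y)) * Real.exp (-((1 - 3 * d) * y)) := by
      refine (hexp _).trans ?_
      rw [← Real.exp_add, Real.exp_le_exp, Nat.cast_sub h3]
      push_cast
      nlinarith [mul_le_mul_of_nonneg_left hdn hp.1]
    have h5 : y * Real.exp (-(d * y)) ≤ 1 / d := by
      rw [le_div_iff₀ hd0]
      have h6 := Real.add_one_le_exp (d * y)
      rw [Real.exp_neg]
      have h7 := Real.exp_pos (d * y)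
      rw [mul_assoc, mul_comm, mul_assoc, inv_mul_le_iff₀ h7]
      linarith
    have h8 : Real.exp (-((1 - 3 * d) * y)) ≤ K / n := by
      have h9 : K / n = Real.exp (-(1 + ε / 4) * Real.log n) := by
        rw [hKexp, neg_add, add_mul, Real.exp_add, mul_comm, div_eq_mul_inv]
        simp [Real.exp_neg, Real.exp_log hnpos, mul_comm]
      rw [h9, Real.exp_le_exp]
      have h10 : 0 ≤ 1 - 3 * d := by
        have : d ≤ 1 / 4 := by
          rw [hd, div_le_div_iff₀ (by positivity) (by norm_num)]; linarith
        linarith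
      have h11 := mul_le_mul_of_nonneg_left hyl h10
      have h12 : (1 - 3 * d) * ((1 + ε) * Real.log n) = (1 + ε / 4) * Real.log n := by
        linear_combination (-3 * Real.log n) * hdε
      linarith
    calc p * (1 - p) ^ (n ^ 2 - 4 * n)
        ≤ p * (Real.exp (-(d * y)) * Real.exp (-((1 - 3 * d) * y))) :=
          mul_le_mul_of_nonneg_left h4 hp.1
      _ = 1 / (n : ℝ) ^ 2 * (y * Real.exp (-(d * y))) * Real.exp (-((1 - 3 * d) * y)) := by
          rw [hy]; field_simp
      _ ≤ 1 / (n : ℝ) ^ 2 * (1 / d) * (K / n) := by gcongr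
  have hcount : ((n : ℝ) ^ 2 + 1) * (n + 1) ≤ 4 * (n : ℝ) ^ 3 := by nlinarith [sq_nonneg (n : ℝ)]
  have hK0 : 0 ≤ K := by rw [hKexp]; positivity
  calc _ ≤ 2 * K + 4 * (n : ℝ) ^ 3 * (1 / (n : ℝ) ^ 2 * (1 / d) * (K / n)) := by
        have := mul_nonneg hp.1 (pow_nonneg hp1 (n ^ 2 - 4 * n))
        gcongr
    _ = (2 + 16 * (1 + ε) / ε) * K := by
        rw [hd]; field_simp; ring

theorem theorem7 :
    (∀ (n : ℕ) (q : I),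
      ∫ A, (numUncovered n A : ℝ) ∂(selectionModel n q) =
        (n ! : ℝ) * (1 - (q : ℝ)) ^ (n ^ 2 + 1)) ∧
    ∀ (ε : ℝ), 0 < ε → ∀ (p : ℕ → I),
      (∀ᶠ n : ℕ in atTop, (1 + ε) * (Real.log (n : ℝ) / (n : ℝ) ^ 2) ≤ (p n : ℝ)) →
      Tendsto (fun n : ℕ => tvDist (uncoveredLaw n (p n)) (poissonMeasure (uncoveredMean n (p n))))
        atTop (𝓝 0) := by
  refine ⟨integral_numUncovered, fun ε hε p hp => ?_⟩
  have hlim : Tendsto (fun n : ℕ => (2 + 16 * (1 + ε) / ε) * (n : ℝ) ^ (-(ε / 4))) atTop (𝓝 0) := by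
    have := ((tendsto_rpow_neg_atTop (y := ε / 4) (by positivity)).comp
      tendsto_natCast_atTop_atTop).const_mul (2 + 16 * (1 + ε) / ε)
    simpa using this
  refine squeeze_zero' (Eventually.of_forall fun n => Real.iSup_nonneg fun S => abs_nonneg _) ?_ hlim
  filter_upwards [hp, eventually_ge_atTop 4,
    tendsto_natCast_atTop_atTop.eventually_ge_atTop (8 * (1 + ε) / ε)] with n h1 h2 h3
  exact (tvDist_uncoveredLaw_le h2 (p n)).trans (approximation_error_le hε h2 h3 (p n).2 h1)
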